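/- Let $H\in(0,\tfrac12)$ and let $B^H=(B^H_t)_{t\ge0}$ be a fractional Brownian motion with Hurst parameter $H$, i.e. a centred Gaussian process with continuous paths and covariance $\mathbf{E}B^H_sB^H_t=\tfrac12(s^{2H}+t^{2H}-|s-t|^{2H})$, $s,t\ge 0$. Then the maxima $\max_{0\le t\le1}B^H_t$ and $\max_{1\le i\le n}B^H_{i/n}$, $n\ge1$, are integrable; put $$\Delta_n^H=\mathbf{E}\max_{0\le t\le1}B^H_t-\mathbf{E}\max_{1\le i\le n}B^H_{i/n},\qquad n\ge1 .$$ (a) For every real $\alpha>0$ and every integer $n\ge \max\bigl\{2^{1/\alpha},\,(1+\tfrac{\alpha}{1+\alpha})^{1/(2\alpha H)}\bigr\}$ for which $\lfloor n^\alpha\rfloor^{-H}(1+\tfrac{\alpha}{1+\alpha})^{1/2}<1$, one has $$\frac{\Delta_n^H}{n^{-H}(\ln n)^{1/2}}\le R_H(\alpha,n):=\frac{(1-\lfloor n^\alpha\rfloor^{-1})^H(1+\alpha)^{1/2}}{1-\lfloor n^\alpha\rfloor^{-H}\bigl(1+\frac{\alpha}{1+\alpha}\bigr)^{1/2}} .$$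 (b) If $\alpha=\alpha(n)\to0$ so slowly that $n^{\alpha(n)}\to\infty$ as $n\to\infty$ (for example $\alpha(n)=(\ln\ln n)/\ln n$), then for all sufficiently large $n$ one has $\alpha(n)>0$ and the pair $(\alpha(n),n)$ satisfies the conditions in (a), and $R_H(\alpha(n),n)\to1$. Consequently, for every fixed $H\in(0,\tfrac12)$, $$\Delta_n^H\le n^{-H}(\ln n)^{1/2}(1+o(1)),\qquad n\to\infty .$$ -/

import Mathlib

open MeasureTheory ProbabilityTheory Filter Topology
open scoped NNReal

/-- `B` is a fractional Brownian motion with Hurst parameter `H` under `P`: a centred Gaussian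
process on `[0, ∞)` with (almost surely) continuous paths and covariance function
`(s ^ (2H) + t ^ (2H) - |s - t| ^ (2H)) / 2`. (That the process is Gaussian includes that `P` is a
probability measure and that every `B t` is almost everywhere measurable.) -/
structure IsFractionalBrownianMotion {Ω : Type*} [MeasurableSpace Ω]
    (H : ℝ) (B : ℝ≥0 → Ω → ℝ) (P : Measure Ω) : Prop where
  isGaussianProcess : IsGaussianProcess B P
  mean_eq_zero : ∀ t, ∫ ω, B t ω ∂P = 0
  covariance_eq : ∀ s t : ℝ≥0, ∫ ω, B s ω * B t ω ∂P =
    ((s : ℝ) ^ (2 * H) + (t : ℝ) ^ (2 * H) - |(s : ℝ) - (t : ℝ)| ^ (2 * H)) / 2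
  continuous_paths : ∀ᵐ ω ∂P, Continuous fun t => B t ω

/-- `max_{0 ≤ t ≤ 1} B_t`. -/
noncomputable def unitMax {Ω : Type*} (B : ℝ≥0 → Ω → ℝ) (ω : Ω) : ℝ :=
  ⨆ t : Set.Icc (0 : ℝ≥0) 1, B t ω

/-- `max_{1 ≤ i ≤ n} B_{i / n}`, for `n ≥ 1`. -/
noncomputable def gridMax {Ω : Type*} (B : ℝ≥0 → Ω → ℝ) (n : ℕ) (ω : Ω) : ℝ :=
  ⨆ i : Set.Icc 1 n, B (((i : ℕ) : ℝ≥0) / (n : ℝ≥0)) ω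

/-- `Δ_n = E max_{0 ≤ t ≤ 1} B_t - E max_{1 ≤ i ≤ n} B_{i / n}`. -/
noncomputable def discretizationError {Ω : Type*} [MeasurableSpace Ω]
    (B : ℝ≥0 → Ω → ℝ) (P : Measure Ω) (n : ℕ) : ℝ :=
  (∫ ω, unitMax B ω ∂P) - ∫ ω, gridMax B n ω ∂P

/-- The ratio `⌊n ^ α⌋ ^ (-H) * (1 + α / (1 + α)) ^ (1 / 2)`, subtracted from `1` in the denominator
of the bound. -/
noncomputable def geomRatio (H α : ℝ) (n : ℕ) : ℝ :=
  (⌊(n : ℝ) ^ α⌋₊ : ℝ) ^ (-H) * (1 + α / (1 + α)) ^ (1 / 2 : ℝ)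

/-- The admissible pairs `(α, n)`: `α > 0`, `n ≥ 2 ^ (1/α) ∨ (1 + α/(1+α)) ^ (1/(2αH))`, and the
denominator `1 - ⌊n ^ α⌋ ^ (-H) * (1 + α/(1+α)) ^ (1/2)` of the bound is positive. -/
def Admissible (H α : ℝ) (n : ℕ) : Prop :=
  0 < α ∧
  max ((2 : ℝ) ^ (1 / α)) ((1 + α / (1 + α)) ^ (1 / (2 * α * H))) ≤ (n : ℝ) ∧
  geomRatio H α n < 1

/-- The bound
`(1 - ⌊n ^ α⌋⁻¹) ^ H (1 + α) ^ (1/2) / (1 - ⌊n ^ α⌋ ^ (-H) (1 + α / (1 + α)) ^ (1/2))`. -/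
noncomputable def upperFactor (H α : ℝ) (n : ℕ) : ℝ :=
  (1 - (⌊(n : ℝ) ^ α⌋₊ : ℝ)⁻¹) ^ H * (1 + α) ^ (1 / 2 : ℝ) / (1 - geomRatio H α n)

/-!
The grid of mesh `1 / n` is refined successively by the factor `m = ⌊n ^ α⌋`. For almost every
path the maxima over the grids of mesh `1 / (n m ^ k)` converge to the maximum over `[0, 1]`, so
the discretization error is the sum over `k` of the gains in expected maximum between consecutive
grids.

Each gain is bounded by Chatterjee's estimate in the Sudakov–Fernique inequality
(`integral_iSup_sub_le_sqrt`): if the variances of the differences of coordinates of two centred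
Gaussian vectors satisfy `E (Y i - Y j) ^ 2 ≤ E (X i - X j) ^ 2 + γ`, then the expected maximum of
`Y` exceeds that of `X` by at most `√(γ log N)`, with `N` the number of coordinates. A crude union
bound would lose a factor `√2`. It is applied to the process on the fine grid and to its values at
the next coarse grid points to the right; as `x ↦ x ^ (2 H)` is subadditive, one may take `γ = ((1
- 1 / m) / (n m ^ k)) ^ (2 H)` (`integral_gridMax_mul_le`). Since `log (n m ^ (k + 1)) ≤ (1 + (k +
1) α) log n`, Bernoulli's inequality dominates the gains by a geometric sequence whose ratio is
`geomRatio` (`Admissible.sqrt_le`), and its sum is the asserted bound.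

Chatterjee's estimate is proved for the smooth maximum `β⁻¹ log ∑ exp (β x i)`, which differs from
the maximum by at most `log N / β`; the choice of `β` is optimised at the end. The Gaussian
interpolation is discrete: a centred Gaussian vector is a sum of `K` independent copies of itself
scaled by `1 / √K`, and these are exchanged one at a time (`integral_softMax_exchange_le`). The
symmetry of the copies leaves only the second difference of the smooth maximum, which has a closed
form in terms of coordinate differences (`softMax_add_add_softMax_sub`), so neither derivatives
nor Gaussian integration by parts are needed; an exchange costs `β γ / (4 K) + O(K⁻²)`.

The same uniform bound on the expected grid maxima gives, by Fatou's lemma, the integrability of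
the maximum over `[0, 1]` (`Admissible.integrable_unitMax`); admissible pairs exist because `α =
ln ln n / ln n` is eventually admissible.
-/

/-! ### The smooth maximum and its second differences -/

/-- The smooth maximum (log-sum-exp) `β⁻¹ log ∑ exp (β x i)` of a finite family. -/
noncomputable def softMax {ι : Type*} [Fintype ι] (β : ℝ) (x : ι → ℝ) : ℝ :=
  β⁻¹ * Real.log (∑ i, Real.exp (β * x i))

section SoftMax

variable {ι : Type*} [Fintype ι]

theorem iSup_le_softMax [Nonempty ι] {β : ℝ} (hβ : 0 < β) (x : ι → ℝ) :
    ⨆ i, x i ≤ softMax β x := by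
  refine ciSup_le fun i => ?_
  have h : Real.exp (β * x i) ≤ ∑ j, Real.exp (β * x j) :=
    Finset.single_le_sum (f := fun j => Real.exp (β * x j)) (fun j _ => (Real.exp_pos _).le)
      (Finset.mem_univ i)
  have h2 := Real.log_le_log (Real.exp_pos _) h
  rw [Real.log_exp] at h2
  rw [softMax, inv_mul_eq_div, le_div_iff₀ hβ]
  linarith

theorem softMax_le [Nonempty ι] {β : ℝ} (hβ : 0 < β) (x : ι → ℝ) :
    softMax β x ≤ (⨆ i, x i) + Real.log (Fintype.card ι) / β := by
  have h : ∑ i, Real.exp (β * x i) ≤ Fintype.card ι * Real.exp (β * ⨆ i, x i) := by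
    rw [← nsmul_eq_mul]
    refine Finset.sum_le_card_nsmul _ _ _ fun i _ => ?_
    gcongr
    exact le_ciSup (Set.finite_range x).bddAbove i
  have hpos : 0 < ∑ i, Real.exp (β * x i) :=
    Finset.sum_pos (fun i _ => Real.exp_pos _) Finset.univ_nonempty
  have hcard : (Fintype.card ι : ℝ) ≠ 0 := by exact_mod_cast Fintype.card_ne_zero
  have h2 := Real.log_le_log hpos h
  rw [Real.log_mul hcard (Real.exp_pos _).ne', Real.log_exp] at h2
  rw [softMax, inv_mul_eq_div, div_le_iff₀ hβ, add_mul, div_mul_cancel₀ _ hβ.ne']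
  linarith

theorem abs_iSup_le_norm [Nonempty ι] (x : ι → ℝ) : |⨆ i, x i| ≤ ‖x‖ := by
  rw [abs_le]
  constructor
  · obtain ⟨i⟩ := ‹Nonempty ι›
    have h1 := le_ciSup (Set.finite_range x).bddAbove i
    have h2 := neg_le_of_abs_le (norm_le_pi_norm x i)
    linarith
  · exact ciSup_le fun i => le_of_abs_le (norm_le_pi_norm x i)

theorem abs_softMax_le [Nonempty ι] {β : ℝ} (hβ : 0 < β) (x : ι → ℝ) :
    |softMax β x| ≤ ‖x‖ + Real.log (Fintype.card ι) / β := by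
  have h1 := iSup_le_softMax hβ x
  have h2 := softMax_le hβ x
  have h3 := abs_le.1 (abs_iSup_le_norm x)
  have h4 : 0 ≤ Real.log (Fintype.card ι) / β :=
    div_nonneg (Real.log_natCast_nonneg _) hβ.le
  rw [abs_le]
  constructor <;> linarith

theorem continuous_softMax [Nonempty ι] (β : ℝ) : Continuous (softMax β : (ι → ℝ) → ℝ) := by
  unfold softMax
  refine continuous_const.mul (Continuous.log (by fun_prop) fun x => ?_)
  exact (Finset.sum_pos (fun i _ => Real.exp_pos _) Finset.univ_nonempty).ne'

theorem sum_exp_mul_sum_exp_neg (p a : ι → ℝ) :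
    (∑ i, p i * Real.exp (a i)) * (∑ i, p i * Real.exp (-a i)) =
      ∑ i, ∑ j, p i * p j * Real.cosh (a i - a j) := by
  have h1 : (∑ i, p i * Real.exp (a i)) * (∑ i, p i * Real.exp (-a i)) =
      ∑ i, ∑ j, p i * p j * Real.exp (a i - a j) := by
    rw [Finset.sum_mul_sum]
    refine Finset.sum_congr rfl fun i _ => Finset.sum_congr rfl fun j _ => ?_
    rw [sub_eq_add_neg, Real.exp_add]
    ring
  have h2 : ∑ i, ∑ j, p i * p j * Real.exp (a i - a j) =
      ∑ i, ∑ j, p i * p j * Real.exp (-(a i - a j)) := by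
    rw [Finset.sum_comm]
    refine Finset.sum_congr rfl fun i _ => Finset.sum_congr rfl fun j _ => ?_
    rw [neg_sub]
    ring
  have h3 : ∑ i, ∑ j, p i * p j * Real.cosh (a i - a j) =
      ((∑ i, ∑ j, p i * p j * Real.exp (a i - a j)) +
        ∑ i, ∑ j, p i * p j * Real.exp (-(a i - a j))) / 2 := by
    simp_rw [← Finset.sum_add_distrib, Finset.sum_div]
    refine Finset.sum_congr rfl fun i _ => Finset.sum_congr rfl fun j _ => ?_
    rw [Real.cosh_eq]
    ring
  rw [h3, ← h2, h1]
  ring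

/-- The Gibbs weights `exp (β w i) / ∑ exp (β w j)`, the gradient of `softMax β` at `w`. -/
noncomputable def gibbsWeight (β : ℝ) (w : ι → ℝ) (i : ι) : ℝ :=
  Real.exp (β * w i) / ∑ j, Real.exp (β * w j)

theorem gibbsWeight_nonneg (β : ℝ) (w : ι → ℝ) (i : ι) : 0 ≤ gibbsWeight β w i := by
  unfold gibbsWeight
  positivity

theorem sum_gibbsWeight [Nonempty ι] (β : ℝ) (w : ι → ℝ) : ∑ i, gibbsWeight β w i = 1 := by
  unfold gibbsWeight
  rw [← Finset.sum_div, div_self]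
  exact (Finset.sum_pos (fun i _ => Real.exp_pos _) Finset.univ_nonempty).ne'

theorem sum_sum_gibbsWeight [Nonempty ι] (β : ℝ) (w : ι → ℝ) :
    ∑ i, ∑ j, gibbsWeight β w i * gibbsWeight β w j = 1 := by
  rw [← Finset.sum_mul_sum, sum_gibbsWeight, one_mul]

/-- The second difference of `softMax` is exact and expressed by differences of coordinates only;
this replaces a Taylor expansion of `softMax`. -/
theorem softMax_add_add_softMax_sub [Nonempty ι] (β : ℝ) (w y : ι → ℝ) :
    softMax β (w + y) + softMax β (w - y) = 2 * softMax β w +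
      β⁻¹ * Real.log (∑ i, ∑ j, gibbsWeight β w i * gibbsWeight β w j *
        Real.cosh (β * (y i - y j))) := by
  have hS : 0 < ∑ i, Real.exp (β * w i) :=
    Finset.sum_pos (fun i _ => Real.exp_pos _) Finset.univ_nonempty
  have key : ∀ z : ι → ℝ, ∑ i, Real.exp (β * (w i + z i)) =
      (∑ i, Real.exp (β * w i)) * ∑ i, gibbsWeight β w i * Real.exp (β * z i) := by
    intro z
    rw [Finset.mul_sum]
    refine Finset.sum_congr rfl fun i _ => ?_
    rw [gibbsWeight, mul_add, Real.exp_add]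
    field_simp
  have hpos : ∀ z : ι → ℝ, 0 < ∑ i, gibbsWeight β w i * Real.exp (β * z i) := fun z =>
    Finset.sum_pos (fun i _ => by unfold gibbsWeight; positivity) Finset.univ_nonempty
  have h2 := sum_exp_mul_sum_exp_neg (gibbsWeight β w) fun i => β * y i
  simp only [← mul_sub] at h2
  rw [← h2]
  have h3 := hpos y
  have h4 := hpos fun i => -y i
  have k1 := key y
  have k2 := key fun i => -y i
  simp only [mul_neg] at h4 k2
  simp only [← sub_eq_add_neg] at k2
  simp only [softMax, Pi.add_apply, Pi.sub_apply]
  rw [k1, k2, Real.log_mul hS.ne' h3.ne', Real.log_mul hS.ne' h4.ne', Real.log_mul h3.ne' h4.ne']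
  ring

theorem softMax_add_add_softMax_sub_le [Nonempty ι] {β : ℝ} (hβ : 0 < β) (w y : ι → ℝ) :
    softMax β (w + y) + softMax β (w - y) ≤ 2 * softMax β w +
      β⁻¹ * ((∑ i, ∑ j, gibbsWeight β w i * gibbsWeight β w j *
        Real.cosh (β * (y i - y j))) - 1) := by
  rw [softMax_add_add_softMax_sub]
  gcongr
  refine Real.log_le_sub_one_of_pos (Finset.sum_pos (fun i _ => Finset.sum_pos (fun j _ => ?_)
    Finset.univ_nonempty) Finset.univ_nonempty)
  unfold gibbsWeight
  have := Real.cosh_pos (β * (y i - y j))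
  positivity

theorem sub_sq_div_two_le_log_one_add {x : ℝ} (hx : 0 ≤ x) :
    x - x ^ 2 / 2 ≤ Real.log (1 + x) := by
  refine le_trans ?_ (Real.le_log_one_add_of_nonneg hx)
  rw [le_div_iff₀ (by positivity)]
  nlinarith [pow_nonneg hx 3]

theorem one_add_sq_div_two_le_cosh (x : ℝ) : 1 + x ^ 2 / 2 ≤ Real.cosh x := by
  have h := sum_le_hasSum (Finset.range 2) (fun n _ => div_nonneg
    ((even_two_mul n).pow_nonneg x) (Nat.cast_nonneg _)) (Real.hasSum_cosh x)
  simpa [Finset.sum_range_succ] using h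

/-- With `V` the quadratic part of the sum of hyperbolic cosines, `V ≤ 2 β ^ 2 ‖y‖ ^ 2`, this is
`log (1 + V) ≥ V - V ^ 2 / 2`. -/
theorem le_softMax_add_add_softMax_sub [Nonempty ι] {β : ℝ} (hβ : 0 < β) (w y : ι → ℝ) :
    2 * softMax β w +
      β⁻¹ * ((∑ i, ∑ j, gibbsWeight β w i * gibbsWeight β w j *
        ((β * (y i - y j)) ^ 2 / 2)) - 2 * β ^ 4 * ‖y‖ ^ 4) ≤
    softMax β (w + y) + softMax β (w - y) := by
  rw [softMax_add_add_softMax_sub]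
  have hp := gibbsWeight_nonneg β w
  set V := ∑ i, ∑ j, gibbsWeight β w i * gibbsWeight β w j * ((β * (y i - y j)) ^ 2 / 2) with hV
  have hV0 : 0 ≤ V := Finset.sum_nonneg fun i _ => Finset.sum_nonneg fun j _ =>
    mul_nonneg (mul_nonneg (hp i) (hp j)) (by positivity)
  have hV1 : V ≤ 2 * β ^ 2 * ‖y‖ ^ 2 := by
    calc V ≤ ∑ i, ∑ j, gibbsWeight β w i * gibbsWeight β w j * (2 * β ^ 2 * ‖y‖ ^ 2) := by
          refine Finset.sum_le_sum fun i _ => Finset.sum_le_sum fun j _ => ?_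
          refine mul_le_mul_of_nonneg_left ?_ (mul_nonneg (hp i) (hp j))
          have h1 : |y i - y j| ≤ 2 * ‖y‖ := by
            have := norm_le_pi_norm y i
            have := norm_le_pi_norm y j
            have := abs_sub (y i) (y j)
            simp only [Real.norm_eq_abs] at *
            linarith
          have h2 : (y i - y j) ^ 2 ≤ (2 * ‖y‖) ^ 2 := sq_le_sq' (by linarith [abs_le.1 h1])
            (abs_le.1 h1).2
          nlinarith [sq_nonneg β]
      _ = 2 * β ^ 2 * ‖y‖ ^ 2 := by
          simp_rw [← Finset.sum_mul]
          rw [sum_sum_gibbsWeight, one_mul]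
  have hcosh : 1 + V ≤ ∑ i, ∑ j, gibbsWeight β w i * gibbsWeight β w j *
        Real.cosh (β * (y i - y j)) := by
    rw [← sum_sum_gibbsWeight β w, hV]
    simp_rw [← Finset.sum_add_distrib]
    refine Finset.sum_le_sum fun i _ => Finset.sum_le_sum fun j _ => ?_
    rw [← mul_one_add]
    exact mul_le_mul_of_nonneg_left (one_add_sq_div_two_le_cosh _) (mul_nonneg (hp i) (hp j))
  have h1 := Real.log_le_log (by positivity) hcosh
  have h2 := sub_sq_div_two_le_log_one_add hV0
  gcongr
  have h3 : V ^ 2 ≤ (2 * β ^ 2 * ‖y‖ ^ 2) ^ 2 := by gcongr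
  nlinarith

end SoftMax

/-! ### Gaussian perturbations of the smooth maximum -/

section Gaussian

variable {ι : Type*} [Fintype ι]

open Complex in
theorem charFunDual_map_sqrt_smul (μ : Measure (ι → ℝ)) [IsGaussian μ] (hμ : ∫ x, x ∂μ = 0)
    {s : ℝ} (hs : 0 ≤ s) (L : StrongDual ℝ (ι → ℝ)) :
    charFunDual (μ.map fun x => √s • x) L = exp (-(s * Var[L; μ]) / 2) := by
  have h : (fun x : ι → ℝ => √s • x) = ⇑(√s • ContinuousLinearMap.id ℝ (ι → ℝ)) := rfl
  rw [h, charFunDual_map, IsGaussian.charFunDual_eq_of_integral_eq_zero hμ]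
  have h2 : ⇑(L.comp (√s • ContinuousLinearMap.id ℝ (ι → ℝ))) = fun x => √s * L x := by
    ext x; simp
  rw [h2, variance_const_mul, Real.sq_sqrt hs]
  push_cast
  rfl

instance isGaussian_map_smul (μ : Measure (ι → ℝ)) [IsGaussian μ] (c : ℝ) :
    IsGaussian (μ.map fun x => c • x) :=
  isGaussian_map (c • ContinuousLinearMap.id ℝ (ι → ℝ))

/-- The laws of `√s X`, for a centred Gaussian vector `X`, form a convolution semigroup in `s`. -/
theorem map_sqrt_smul_conv (μ : Measure (ι → ℝ)) [IsGaussian μ] (hμ : ∫ x, x ∂μ = 0)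
    {s t : ℝ} (hs : 0 ≤ s) (ht : 0 ≤ t) :
    (μ.map fun x => √s • x) ∗ (μ.map fun x => √t • x) = μ.map fun x => √(s + t) • x := by
  refine Measure.ext_of_charFunDual ?_
  ext L
  rw [charFunDual_conv, charFunDual_map_sqrt_smul μ hμ hs, charFunDual_map_sqrt_smul μ hμ ht,
    charFunDual_map_sqrt_smul μ hμ (add_nonneg hs ht), ← Complex.exp_add]
  congr 1
  push_cast
  ring

theorem map_neg_eq_self (μ : Measure (ι → ℝ)) [IsGaussian μ] (hμ : ∫ x, x ∂μ = 0) :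
    (μ.map fun x => -x) = μ := by
  have h : (fun x : ι → ℝ => -x) = ⇑(-ContinuousLinearMap.id ℝ (ι → ℝ)) := rfl
  refine Measure.ext_of_charFunDual ?_
  ext L
  rw [h, charFunDual_map, IsGaussian.charFunDual_eq_of_integral_eq_zero hμ,
    IsGaussian.charFunDual_eq_of_integral_eq_zero hμ]
  have h2 : ⇑(L.comp (-ContinuousLinearMap.id ℝ (ι → ℝ))) = fun x => (-1) * L x := by
    ext x; simp
  rw [h2, variance_const_mul]
  simp

theorem integrable_softMax [Nonempty ι] (μ : Measure (ι → ℝ)) [IsGaussian μ] {β : ℝ}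
    (hβ : 0 < β) : Integrable (softMax β) μ := by
  refine Integrable.mono' ((IsGaussian.integrable_id (μ := μ)).norm.add
    (integrable_const (Real.log (Fintype.card ι) / β)))
    (continuous_softMax β).aestronglyMeasurable (ae_of_all _ fun x => ?_)
  simpa using abs_softMax_le hβ x

theorem integrable_softMax_add_smul [Nonempty ι] (μ : Measure (ι → ℝ)) [IsGaussian μ] {β : ℝ}
    (hβ : 0 < β) (w : ι → ℝ) (c : ℝ) : Integrable (fun x => softMax β (w + c • x)) μ := by
  have h : Integrable (softMax β) ((μ.map fun x => c • x).map fun x => w + x) :=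
    integrable_softMax _ hβ
  rw [Measure.map_map (by fun_prop) (by fun_prop)] at h
  exact (integrable_map_measure h.1 (by fun_prop)).1 h

/-- By the symmetry of `μ` the first-order term vanishes and only the second difference remains. -/
theorem two_mul_integral_softMax [Nonempty ι] (μ : Measure (ι → ℝ)) [IsGaussian μ]
    (hμ : ∫ x, x ∂μ = 0) {β : ℝ} (hβ : 0 < β) (w : ι → ℝ) (c : ℝ) :
    2 * ∫ x, softMax β (w + c • x) ∂μ =
      ∫ x, (softMax β (w + c • x) + softMax β (w - c • x)) ∂μ := by
  have h1 : ∫ x, softMax β (w + c • x) ∂μ = ∫ x, softMax β (w - c • x) ∂μ := by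
    have hc : Continuous fun x : ι → ℝ => softMax β (w + c • x) :=
      (continuous_softMax β).comp (by fun_prop)
    conv_lhs => rw [← map_neg_eq_self μ hμ]
    rw [integral_map (by fun_prop) hc.aestronglyMeasurable]
    simp [sub_eq_add_neg]
  have h2 : Integrable (fun x => softMax β (w - c • x)) μ := by
    simpa [sub_eq_add_neg] using integrable_softMax_add_smul μ hβ w (-c)
  rw [integral_add (integrable_softMax_add_smul μ hβ w c) h2, ← h1]
  ring

/-- The difference of two coordinates is a centred real Gaussian variable. -/
theorem map_coord_sub (μ : Measure (ι → ℝ)) [IsGaussian μ] (hμ : ∫ x, x ∂μ = 0) (i j : ι) :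
    μ.map (fun x => x i - x j) = gaussianReal 0 (∫ x, (x i - x j) ^ 2 ∂μ).toNNReal := by
  let L : StrongDual ℝ (ι → ℝ) := 
    ContinuousLinearMap.proj (R := ℝ) (φ := fun _ : ι => ℝ) i -
      ContinuousLinearMap.proj (R := ℝ) (φ := fun _ : ι => ℝ) j
  have hL : ∀ x, L x = x i - x j := fun x => rfl
  have h0 : μ[L] = 0 := by rw [IsGaussian.integral_dual, hμ, map_zero]
  have h := IsGaussian.map_eq_gaussianReal (μ := μ) L
  rw [h0, variance_of_integral_eq_zero (by fun_prop) h0] at h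
  exact h

theorem integrable_exp_coord_sub (μ : Measure (ι → ℝ)) [IsGaussian μ] (hμ : ∫ x, x ∂μ = 0)
    (i j : ι) (t : ℝ) : Integrable (fun x => Real.exp (t * (x i - x j))) μ := by
  have h := integrable_exp_mul_gaussianReal (μ := 0)
    (v := (∫ x, (x i - x j) ^ 2 ∂μ).toNNReal) t
  rw [← map_coord_sub μ hμ i j] at h
  exact (integrable_map_measure h.1 (by fun_prop)).1 h

theorem integral_exp_coord_sub (μ : Measure (ι → ℝ)) [IsGaussian μ] (hμ : ∫ x, x ∂μ = 0)
    (i j : ι) (t : ℝ) : ∫ x, Real.exp (t * (x i - x j)) ∂μ =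
      Real.exp (t ^ 2 * (∫ x, (x i - x j) ^ 2 ∂μ) / 2) := by
  have h := mgf_gaussianReal (map_coord_sub μ hμ i j) t
  rw [mgf] at h
  rw [h, Real.coe_toNNReal _ (integral_nonneg fun x => sq_nonneg _)]
  ring_nf

theorem integrable_cosh_coord_sub (μ : Measure (ι → ℝ)) [IsGaussian μ] (hμ : ∫ x, x ∂μ = 0)
    (i j : ι) (t : ℝ) : Integrable (fun x => Real.cosh (t * (x i - x j))) μ := by
  simp_rw [Real.cosh_eq, ← neg_mul]
  exact ((integrable_exp_coord_sub μ hμ i j t).add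
    (integrable_exp_coord_sub μ hμ i j (-t))).div_const 2

theorem integral_cosh_coord_sub (μ : Measure (ι → ℝ)) [IsGaussian μ] (hμ : ∫ x, x ∂μ = 0)
    (i j : ι) (t : ℝ) : ∫ x, Real.cosh (t * (x i - x j)) ∂μ =
      Real.exp (t ^ 2 * (∫ x, (x i - x j) ^ 2 ∂μ) / 2) := by
  simp_rw [Real.cosh_eq, ← neg_mul]
  rw [integral_div, integral_add (integrable_exp_coord_sub μ hμ i j t)
    (integrable_exp_coord_sub μ hμ i j (-t)), integral_exp_coord_sub μ hμ,
    integral_exp_coord_sub μ hμ, neg_sq]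
  ring

theorem integrable_coord_sub_sq (μ : Measure (ι → ℝ)) [IsGaussian μ] (i j : ι) :
    Integrable (fun x => (x i - x j) ^ 2) μ := by
  let L : StrongDual ℝ (ι → ℝ) := 
    ContinuousLinearMap.proj (R := ℝ) (φ := fun _ : ι => ℝ) i -
      ContinuousLinearMap.proj (R := ℝ) (φ := fun _ : ι => ℝ) j
  exact (IsGaussian.memLp_dual μ L 2 (by simp)).integrable_sq

theorem integrable_norm_pow_four (μ : Measure (ι → ℝ)) [IsGaussian μ] :
    Integrable (fun x => ‖x‖ ^ 4) μ :=
  (IsGaussian.memLp_id μ 4 (by simp)).integrable_norm_pow (by norm_num)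

/-- Upper bound for a small Gaussian perturbation, from `log x ≤ x - 1` and the Gaussian moment
generating function. -/
theorem integral_softMax_add_sqrt_smul_le [Nonempty ι] (μ : Measure (ι → ℝ)) [IsGaussian μ]
    (hμ : ∫ x, x ∂μ = 0) {β : ℝ} (hβ : 0 < β) (w : ι → ℝ) {h : ℝ} (hh : 0 ≤ h) :
    2 * ∫ x, softMax β (w + √h • x) ∂μ ≤ 2 * softMax β w +
      β⁻¹ * ((∑ i, ∑ j, gibbsWeight β w i * gibbsWeight β w j *
        Real.exp (β ^ 2 * h * (∫ x, (x i - x j) ^ 2 ∂μ) / 2)) - 1) := by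
  have hint : ∀ i j, Integrable (fun x : ι → ℝ => gibbsWeight β w i * gibbsWeight β w j *
      Real.cosh (β * √h * (x i - x j))) μ := fun i j =>
    (integrable_cosh_coord_sub μ hμ i j _).const_mul _
  have hint2 : Integrable (fun x : ι → ℝ => ∑ i, ∑ j, gibbsWeight β w i * gibbsWeight β w j *
      Real.cosh (β * √h * (x i - x j))) μ :=
    integrable_finsetSum _ fun i _ => integrable_finsetSum _ fun j _ => hint i j
  have hint3 : Integrable (fun x : ι → ℝ => β⁻¹ * ((∑ i, ∑ j, gibbsWeight β w i *
      gibbsWeight β w j * Real.cosh (β * √h * (x i - x j))) - 1)) μ :=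
    (hint2.sub (integrable_const 1)).const_mul _
  have h2 : Integrable (fun x => softMax β (w - √h • x)) μ := by
    simpa [sub_eq_add_neg] using integrable_softMax_add_smul μ hβ w (-√h)
  rw [two_mul_integral_softMax μ hμ hβ]
  calc ∫ x, (softMax β (w + √h • x) + softMax β (w - √h • x)) ∂μ
      ≤ ∫ x, (2 * softMax β w + β⁻¹ * ((∑ i, ∑ j, gibbsWeight β w i * gibbsWeight β w j *
        Real.cosh (β * √h * (x i - x j))) - 1)) ∂μ := by
        refine integral_mono ((integrable_softMax_add_smul μ hβ w _).add h2)
          ((integrable_const _).add hint3) fun x => ?_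
        refine (softMax_add_add_softMax_sub_le hβ w (√h • x)).trans_eq ?_
        simp only [Pi.smul_apply, smul_eq_mul, ← mul_sub, mul_assoc]
    _ = _ := by
        rw [integral_add (integrable_const _) hint3, integral_const_mul β⁻¹,
          integral_sub hint2 (integrable_const _), integral_finsetSum _
            fun i _ => integrable_finsetSum _ fun j _ => hint i j]
        simp_rw [integral_finsetSum _ fun j _ => hint _ j, integral_const_mul,
          integral_cosh_coord_sub μ hμ, mul_pow, Real.sq_sqrt hh]
        simp

/-- Lower bound for a small Gaussian perturbation, with the same second-order term as
`integral_softMax_add_sqrt_smul_le` up to `O(h ^ 2)`. -/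
theorem le_integral_softMax_add_sqrt_smul [Nonempty ι] (μ : Measure (ι → ℝ)) [IsGaussian μ]
    (hμ : ∫ x, x ∂μ = 0) {β : ℝ} (hβ : 0 < β) (w : ι → ℝ) {h : ℝ} (hh : 0 ≤ h) :
    2 * softMax β w + β⁻¹ * ((∑ i, ∑ j, gibbsWeight β w i * gibbsWeight β w j *
        (β ^ 2 * h * (∫ x, (x i - x j) ^ 2 ∂μ) / 2)) - 2 * β ^ 4 * (h ^ 2 * ∫ x, ‖x‖ ^ 4 ∂μ)) ≤
      2 * ∫ x, softMax β (w + √h • x) ∂μ := by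
  have hint : ∀ i j, Integrable (fun x : ι → ℝ => gibbsWeight β w i * gibbsWeight β w j *
      (β ^ 2 * h * (x i - x j) ^ 2 / 2)) μ := fun i j =>
    (((integrable_coord_sub_sq μ i j).const_mul _).div_const 2).const_mul _
  have hint2 : Integrable (fun x : ι → ℝ => ∑ i, ∑ j, gibbsWeight β w i * gibbsWeight β w j *
      (β ^ 2 * h * (x i - x j) ^ 2 / 2)) μ :=
    integrable_finsetSum _ fun i _ => integrable_finsetSum _ fun j _ => hint i j
  have hint3 : Integrable (fun x : ι → ℝ => 2 * β ^ 4 * (h ^ 2 * ‖x‖ ^ 4)) μ :=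
    ((integrable_norm_pow_four μ).const_mul _).const_mul _
  have hint4 : Integrable (fun x : ι → ℝ => β⁻¹ * ((∑ i, ∑ j, gibbsWeight β w i *
      gibbsWeight β w j * (β ^ 2 * h * (x i - x j) ^ 2 / 2)) - 2 * β ^ 4 * (h ^ 2 * ‖x‖ ^ 4))) μ :=
    (hint2.sub hint3).const_mul _
  have h2 : Integrable (fun x => softMax β (w - √h • x)) μ := by
    simpa [sub_eq_add_neg] using integrable_softMax_add_smul μ hβ w (-√h)
  rw [two_mul_integral_softMax μ hμ hβ]
  calc _ = ∫ x, (2 * softMax β w + β⁻¹ * ((∑ i, ∑ j, gibbsWeight β w i * gibbsWeight β w j *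
        (β ^ 2 * h * (x i - x j) ^ 2 / 2)) - 2 * β ^ 4 * (h ^ 2 * ‖x‖ ^ 4))) ∂μ := by
        rw [integral_add (integrable_const _) hint4, integral_const_mul β⁻¹,
          integral_sub hint2 hint3, integral_finsetSum _
            fun i _ => integrable_finsetSum _ fun j _ => hint i j]
        simp_rw [integral_finsetSum _ fun j _ => hint _ j, integral_const_mul, integral_div,
          integral_const_mul]
        simp
    _ ≤ ∫ x, (softMax β (w + √h • x) + softMax β (w - √h • x)) ∂μ := by
        refine integral_mono ((integrable_const _).add hint4)
          ((integrable_softMax_add_smul μ hβ w _).add h2) fun x => ?_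
        refine le_trans (le_of_eq ?_) (le_softMax_add_add_softMax_sub hβ w (√h • x))
        have h4 : √h ^ 4 = h ^ 2 := by
          rw [show 4 = 2 * 2 from rfl, pow_mul, Real.sq_sqrt hh]
        simp only [Pi.smul_apply, smul_eq_mul, ← mul_sub, norm_smul, mul_pow, Real.sq_sqrt hh,
          Real.norm_eq_abs, abs_of_nonneg (Real.sqrt_nonneg h), h4, mul_assoc]

end Gaussian

/-! ### Comparison of expected maxima of Gaussian vectors -/

section Comparison

theorem map_sqrt_zero_smul {ι : Type*} (μ : Measure (ι → ℝ)) [IsProbabilityMeasure μ] :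
    (μ.map fun x => √0 • x) = Measure.dirac 0 := by
  simp

variable {ι : Type*} [Fintype ι] [Nonempty ι]

/-- Replacing a Gaussian perturbation of size `√h` with covariance of `μ` by one with covariance of
`ν`; only the variances of coordinate differences enter, and the error is `O(h ^ 2)`. -/
theorem integral_softMax_sub_le_of_smul (μ ν : Measure (ι → ℝ)) [IsGaussian μ] [IsGaussian ν]
    (hμ : ∫ x, x ∂μ = 0) (hν : ∫ x, x ∂ν = 0) {γ D : ℝ}
    (hγ : ∀ i j, ∫ x, (x i - x j) ^ 2 ∂ν ≤ ∫ x, (x i - x j) ^ 2 ∂μ + γ)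
    (hD : ∀ i j, ∫ x, (x i - x j) ^ 2 ∂ν ≤ D) {β : ℝ} (hβ : 0 < β) (w : ι → ℝ) {h : ℝ}
    (hh : 0 ≤ h) (hsmall : β ^ 2 * h * D / 2 ≤ 1) :
    ∫ x, softMax β (w + √h • x) ∂ν ≤ ∫ x, softMax β (w + √h • x) ∂μ +
      (β * γ / 4 * h + β ^ 3 * (D ^ 2 / 8 + ∫ x, ‖x‖ ^ 4 ∂μ) * h ^ 2) := by
  have h1 := integral_softMax_add_sqrt_smul_le ν hν hβ w hh
  have h2 := le_integral_softMax_add_sqrt_smul μ hμ hβ w hh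
  set M := ∫ x, ‖x‖ ^ 4 ∂μ
  have hp := gibbsWeight_nonneg β w
  have h3 : (∑ i, ∑ j, gibbsWeight β w i * gibbsWeight β w j *
      Real.exp (β ^ 2 * h * (∫ x, (x i - x j) ^ 2 ∂ν) / 2)) ≤
      ∑ i, ∑ j, gibbsWeight β w i * gibbsWeight β w j *
        (β ^ 2 * h * (∫ x, (x i - x j) ^ 2 ∂μ) / 2 +
          (1 + β ^ 2 * h * γ / 2 + (β ^ 2 * h * D / 2) ^ 2)) := by
    refine Finset.sum_le_sum fun i _ => Finset.sum_le_sum fun j _ => ?_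
    refine mul_le_mul_of_nonneg_left ?_ (mul_nonneg (hp i) (hp j))
    have hv : 0 ≤ ∫ x, (x i - x j) ^ 2 ∂ν := integral_nonneg fun x => sq_nonneg _
    have hu : 0 ≤ β ^ 2 * h * (∫ x, (x i - x j) ^ 2 ∂ν) / 2 := by positivity
    have huD : β ^ 2 * h * (∫ x, (x i - x j) ^ 2 ∂ν) / 2 ≤ β ^ 2 * h * D / 2 := by
      gcongr
      exact hD i j
    have huγ : β ^ 2 * h * (∫ x, (x i - x j) ^ 2 ∂ν) / 2 ≤
        β ^ 2 * h * (∫ x, (x i - x j) ^ 2 ∂μ + γ) / 2 := by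
      gcongr
      exact hγ i j
    have he := (abs_le.1 (Real.abs_exp_sub_one_sub_id_le
      (abs_le.2 ⟨by linarith, huD.trans hsmall⟩))).2
    have hsq := pow_le_pow_left₀ hu huD 2
    linarith
  simp_rw [mul_add _ (_ / 2 : ℝ) (1 + _ + _), Finset.sum_add_distrib, ← Finset.sum_mul,
    sum_sum_gibbsWeight β w, one_mul] at h3
  have h4 := mul_le_mul_of_nonneg_left h3 (inv_pos.2 hβ).le
  have h5 : β⁻¹ * (β ^ 2 * h * γ / 2 + (β ^ 2 * h * D / 2) ^ 2 + 2 * β ^ 4 * (h ^ 2 * M)) =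
      2 * (β * γ / 4 * h + β ^ 3 * (D ^ 2 / 8 + M) * h ^ 2) := by
    field_simp
    ring
  linarith

theorem integral_conv_map_smul (W μ : Measure (ι → ℝ)) [IsGaussian W] [IsGaussian μ] {β : ℝ}
    (hβ : 0 < β) (c : ℝ) :
    Integrable (fun w => ∫ x, softMax β (w + c • x) ∂μ) W ∧
    ∫ x, softMax β x ∂(W ∗ μ.map fun x => c • x) =
      ∫ w, ∫ x, softMax β (w + c • x) ∂μ ∂W := by
  have hi := integrable_softMax (W ∗ μ.map fun x => c • x) hβ
  have h : ∀ w : ι → ℝ, ∫ x, softMax β (w + x) ∂(μ.map fun x => c • x) =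
      ∫ x, softMax β (w + c • x) ∂μ := fun w =>
    integral_map (by fun_prop)
      ((continuous_softMax β).comp (continuous_const.add continuous_id)).aestronglyMeasurable
  rw [integral_conv hi]
  simp_rw [h]
  refine ⟨?_, trivial⟩
  have hi2 : Integrable (fun p : (ι → ℝ) × (ι → ℝ) => softMax β (p.1 + p.2))
      (W.prod (μ.map fun x => c • x)) :=
    (integrable_map_measure hi.1 (by fun_prop)).1 hi
  simpa [h] using hi2.integral_prod_left

/-- One exchange of an independent component: a share `h` of the variance is moved from `μ`
to `ν`. -/
theorem integral_softMax_exchange_le (μ ν : Measure (ι → ℝ)) [IsGaussian μ] [IsGaussian ν]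
    (hμ : ∫ x, x ∂μ = 0) (hν : ∫ x, x ∂ν = 0) {γ D : ℝ}
    (hγ : ∀ i j, ∫ x, (x i - x j) ^ 2 ∂ν ≤ ∫ x, (x i - x j) ^ 2 ∂μ + γ)
    (hD : ∀ i j, ∫ x, (x i - x j) ^ 2 ∂ν ≤ D) {β : ℝ} (hβ : 0 < β) {h s t : ℝ}
    (hh : 0 ≤ h) (hs : 0 ≤ s) (ht : 0 ≤ t) (hsmall : β ^ 2 * h * D / 2 ≤ 1) :
    ∫ x, softMax β x ∂((μ.map fun x => √s • x) ∗ ν.map fun x => √(t + h) • x) ≤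
      ∫ x, softMax β x ∂((μ.map fun x => √(s + h) • x) ∗ ν.map fun x => √t • x) +
      (β * γ / 4 * h + β ^ 3 * (D ^ 2 / 8 + ∫ x, ‖x‖ ^ 4 ∂μ) * h ^ 2) := by
  rw [← map_sqrt_smul_conv ν hν ht hh, ← map_sqrt_smul_conv μ hμ hs hh, ← Measure.conv_assoc,
    Measure.conv_assoc (μ.map fun x => √s • x) (μ.map fun x => √h • x),
    Measure.conv_comm (μ.map fun x => √h • x), ← Measure.conv_assoc]
  set W := (μ.map fun x => √s • x) ∗ (ν.map fun x => √t • x)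
  obtain ⟨i1, e1⟩ := integral_conv_map_smul W ν hβ √h
  obtain ⟨i2, e2⟩ := integral_conv_map_smul W μ hβ √h
  rw [e1, e2]
  calc _ ≤ ∫ w, ((∫ x, softMax β (w + √h • x) ∂μ) +
        (β * γ / 4 * h + β ^ 3 * (D ^ 2 / 8 + ∫ x, ‖x‖ ^ 4 ∂μ) * h ^ 2)) ∂W :=
        integral_mono i1 (i2.add (integrable_const _)) fun w =>
          integral_softMax_sub_le_of_smul μ ν hμ hν hγ hD hβ w hh hsmall
    _ = _ := by
        rw [integral_add i2 (integrable_const _)]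
        simp

/-- The comparison of smooth maxima: `K` successive exchanges of a share `1 / K` turn `μ` into `ν`,
and the accumulated error `C / K` vanishes as `K → ∞`. -/
theorem integral_softMax_le_add (μ ν : Measure (ι → ℝ)) [IsGaussian μ] [IsGaussian ν]
    (hμ : ∫ x, x ∂μ = 0) (hν : ∫ x, x ∂ν = 0) {γ : ℝ}
    (hγ : ∀ i j, ∫ x, (x i - x j) ^ 2 ∂ν ≤ ∫ x, (x i - x j) ^ 2 ∂μ + γ)
    {β : ℝ} (hβ : 0 < β) :
    ∫ x, softMax β x ∂ν ≤ ∫ x, softMax β x ∂μ + β * γ / 4 := by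
  obtain ⟨D, hD⟩ : ∃ D, ∀ i j, ∫ x, (x i - x j) ^ 2 ∂ν ≤ D := by
    obtain ⟨D, hD⟩ := (Set.finite_range fun p : ι × ι =>
      ∫ x, (x p.1 - x p.2) ^ 2 ∂ν).bddAbove
    exact ⟨D, fun i j => hD ⟨(i, j), rfl⟩⟩
  set C := β ^ 3 * (D ^ 2 / 8 + ∫ x, ‖x‖ ^ 4 ∂μ) with hC
  -- `K ≥ β ^ 2 D / 2` makes a share `1 / K` small enough for `exp u ≤ 1 + u + u ^ 2`.
  have key : ∀ K : ℕ, 0 < K → β ^ 2 * D / 2 ≤ K →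
      ∫ x, softMax β x ∂ν ≤ ∫ x, softMax β x ∂μ + β * γ / 4 + C / K := by
    intro K hK hK2
    have hK' : (0 : ℝ) < K := by exact_mod_cast hK
    have hsmall : β ^ 2 * (1 / K) * D / 2 ≤ 1 := by
      rw [show β ^ 2 * (1 / K : ℝ) * D / 2 = (β ^ 2 * D / 2) / K by ring, div_le_one hK']
      exact hK2
    have ind : ∀ k : ℕ, k ≤ K →
        ∫ x, softMax β x ∂((μ.map fun x => √(((K - k : ℕ) : ℝ) * (1 / K)) • x) ∗
          ν.map fun x => √(k * (1 / K)) • x) ≤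
        ∫ x, softMax β x ∂μ + k * (β * γ / 4 * (1 / K) + C * (1 / K) ^ 2) := by
      intro k
      induction k with
      | zero =>
        intro _
        rw [Nat.cast_zero, zero_mul, zero_mul, map_sqrt_zero_smul, Measure.conv_dirac_zero,
          Nat.sub_zero, mul_one_div_cancel hK'.ne']
        simp
      | succ k ih =>
        intro hk
        have h1 := ih (by omega)
        have h2 := integral_softMax_exchange_le μ ν hμ hν hγ hD hβ (h := 1 / K)
          (s := ((K - (k + 1) : ℕ) : ℝ) * (1 / K)) (t := k * (1 / K)) (by positivity)
          (by positivity) (by positivity) hsmall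
        rw [← hC] at h2
        have e : ((K - k : ℕ) : ℝ) = ((K - (k + 1) : ℕ) : ℝ) + 1 := by
          rw [show K - k = K - (k + 1) + 1 by omega]
          push_cast
          rfl
        rw [e, add_one_mul] at h1
        push_cast
        rw [add_one_mul, add_one_mul]
        linarith
    have h1 := ind K le_rfl
    rw [Nat.sub_self, Nat.cast_zero, zero_mul, map_sqrt_zero_smul, Measure.dirac_zero_conv,
      mul_one_div_cancel hK'.ne'] at h1
    have e : K * (β * γ / 4 * (1 / K) + C * (1 / K : ℝ) ^ 2) = β * γ / 4 + C / K := by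
      field_simp
    rw [e] at h1
    simpa [add_assoc] using h1
  have hlim : Tendsto (fun K : ℕ => ∫ x, softMax β x ∂μ + β * γ / 4 + C / K) atTop
      (𝓝 (∫ x, softMax β x ∂μ + β * γ / 4 + 0)) :=
    tendsto_const_nhds.add (tendsto_const_div_atTop_nhds_zero_nat C)
  rw [add_zero] at hlim
  refine ge_of_tendsto hlim ?_
  filter_upwards [eventually_gt_atTop 0, eventually_ge_atTop ⌈β ^ 2 * D / 2⌉₊] with K h1 h2
  exact key K h1 (Nat.ceil_le.1 h2)

theorem continuous_iSup_coord : Continuous fun x : ι → ℝ => ⨆ i, x i := by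
  have h : (fun x : ι → ℝ => ⨆ i, x i) = fun x =>
      Finset.univ.sup' Finset.univ_nonempty fun i => x i := by
    ext x
    rw [Finset.sup'_univ_eq_ciSup]
  rw [h]
  exact Continuous.finset_sup'_apply _ fun i _ => continuous_apply i

theorem integrable_iSup_coord (μ : Measure (ι → ℝ)) [IsGaussian μ] :
    Integrable (fun x => ⨆ i, x i) μ :=
  Integrable.mono' (IsGaussian.integrable_id (μ := μ)).norm
    continuous_iSup_coord.aestronglyMeasurable (ae_of_all _ fun x => abs_iSup_le_norm x)

/-- **Chatterjee's error bound in the Sudakov–Fernique inequality** (one-sided form). -/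
theorem integral_iSup_sub_le_sqrt (μ ν : Measure (ι → ℝ)) [IsGaussian μ] [IsGaussian ν]
    (hμ : ∫ x, x ∂μ = 0) (hν : ∫ x, x ∂ν = 0) {γ : ℝ} (hγ0 : 0 < γ)
    (hγ : ∀ i j, ∫ x, (x i - x j) ^ 2 ∂ν ≤ ∫ x, (x i - x j) ^ 2 ∂μ + γ)
    (hcard : 1 < Fintype.card ι) :
    ∫ x, ⨆ i, x i ∂ν ≤ ∫ x, ⨆ i, x i ∂μ + √(γ * Real.log (Fintype.card ι)) := by
  set l := Real.log (Fintype.card ι) with hl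
  have hl0 : 0 < l := Real.log_pos (by exact_mod_cast hcard)
  -- The minimiser of `β γ / 4 + l / β`.
  set β := 2 * √l / √γ with hβdef
  have hsl : 0 < √l := Real.sqrt_pos.2 hl0
  have hsγ : 0 < √γ := Real.sqrt_pos.2 hγ0
  have hβ : 0 < β := by positivity
  have h1 : ∫ x, ⨆ i, x i ∂ν ≤ ∫ x, softMax β x ∂ν :=
    integral_mono (integrable_iSup_coord ν) (integrable_softMax ν hβ) (iSup_le_softMax hβ)
  have h2 : ∫ x, softMax β x ∂μ ≤ ∫ x, ((⨆ i, x i) + l / β) ∂μ :=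
    integral_mono (integrable_softMax μ hβ)
      ((integrable_iSup_coord μ).add (integrable_const _)) (softMax_le hβ)
  rw [integral_add (integrable_iSup_coord μ) (integrable_const _)] at h2
  simp only [integral_const, probReal_univ, one_smul] at h2
  have h3 := integral_softMax_le_add μ ν hμ hν hγ hβ
  have e1 : β * γ / 4 = √(γ * l) / 2 := by
    rw [Real.sqrt_mul hγ0.le, hβdef]
    nth_rw 2 [← Real.mul_self_sqrt hγ0.le]
    field_simp
    ring
  have e2 : l / β = √(γ * l) / 2 := by
    rw [Real.sqrt_mul hγ0.le, hβdef]
    nth_rw 1 [← Real.mul_self_sqrt hl0.le]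
    field_simp
  linarith

/-- The comparison for two families of random variables on the same space. -/
theorem integral_iSup_sub_le_sqrt_of_hasGaussianLaw {Ω : Type*} [MeasurableSpace Ω]
    {P : Measure Ω} {X Y : Ω → ι → ℝ} (hX : HasGaussianLaw X P) (hY : HasGaussianLaw Y P)
    (hX0 : ∀ i, ∫ ω, X ω i ∂P = 0) (hY0 : ∀ i, ∫ ω, Y ω i ∂P = 0) {γ : ℝ} (hγ0 : 0 < γ)
    (hγ : ∀ i j, ∫ ω, (Y ω i - Y ω j) ^ 2 ∂P ≤ ∫ ω, (X ω i - X ω j) ^ 2 ∂P + γ)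
    (hcard : 1 < Fintype.card ι) :
    ∫ ω, ⨆ i, Y ω i ∂P ≤ ∫ ω, ⨆ i, X ω i ∂P + √(γ * Real.log (Fintype.card ι)) := by
  have hgX := hX.isGaussian_map
  have hgY := hY.isGaussian_map
  have mean : ∀ Z : Ω → ι → ℝ, HasGaussianLaw Z P → (∀ i, ∫ ω, Z ω i ∂P = 0) →
      ∫ x, x ∂(P.map Z) = 0 := by
    intro Z hZ hZ0
    rw [integral_map hZ.aemeasurable (by fun_prop)]
    ext i
    rw [eval_integral fun i => hZ.integrable.eval i]
    exact hZ0 i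
  have sq : ∀ Z : Ω → ι → ℝ, HasGaussianLaw Z P → ∀ i j,
      ∫ x, (x i - x j) ^ 2 ∂(P.map Z) = ∫ ω, (Z ω i - Z ω j) ^ 2 ∂P := fun Z hZ i j =>
    integral_map hZ.aemeasurable (by fun_prop)
  have sup : ∀ Z : Ω → ι → ℝ, HasGaussianLaw Z P →
      ∫ x, ⨆ i, x i ∂(P.map Z) = ∫ ω, ⨆ i, Z ω i ∂P := fun Z hZ =>
    integral_map hZ.aemeasurable continuous_iSup_coord.aestronglyMeasurable
  have h := integral_iSup_sub_le_sqrt (P.map X) (P.map Y) (mean X hX hX0) (mean Y hY hY0) hγ0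
    (fun i j => by rw [sq X hX, sq Y hY]; exact hγ i j) hcard
  rwa [sup X hX, sup Y hY] at h

theorem integrable_iSup_of_hasGaussianLaw {Ω : Type*} [MeasurableSpace Ω]
    {P : Measure Ω} {X : Ω → ι → ℝ} (hX : HasGaussianLaw X P) :
    Integrable (fun ω => ⨆ i, X ω i) P := by
  have := hX.isGaussian_map
  exact (integrable_map_measure continuous_iSup_coord.aestronglyMeasurable hX.aemeasurable).1
    (integrable_iSup_coord (P.map X))

end Comparison

/-! ### Fractional Brownian motion on refined grids -/

section Path

variable {Ω : Type*} {B : ℝ≥0 → Ω → ℝ} {ω : Ω}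

theorem bddAbove_unitInterval_path (hc : Continuous fun t => B t ω) :
    BddAbove (Set.range fun t : Set.Icc (0 : ℝ≥0) 1 => B t ω) :=
  (isCompact_range (hc.comp continuous_subtype_val)).bddAbove

theorem gridMax_le_unitMax (hc : Continuous fun t => B t ω) {N : ℕ} (hN : 0 < N) :
    gridMax B N ω ≤ unitMax B ω := by
  have : Nonempty (Set.Icc 1 N) := ⟨⟨N, hN, le_rfl⟩⟩
  refine ciSup_le fun i => ?_
  refine le_ciSup (bddAbove_unitInterval_path hc)
    (⟨((i : ℕ) : ℝ≥0) / N, zero_le, div_le_one_of_le₀ ?_ zero_le⟩ : Set.Icc (0 : ℝ≥0) 1)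
  exact_mod_cast i.2.2

theorem le_gridMax {N i : ℕ} (hi : i ∈ Set.Icc 1 N) :
    B ((i : ℝ≥0) / N) ω ≤ gridMax B N ω :=
  le_ciSup (f := fun i : Set.Icc 1 N => B (((i : ℕ) : ℝ≥0) / N) ω)
    (Set.finite_range _).bddAbove ⟨i, hi⟩

theorem apply_one_le_gridMax {N : ℕ} (hN : 0 < N) : B 1 ω ≤ gridMax B N ω := by
  have h := le_gridMax (B := B) (ω := ω) (N := N) (i := N) ⟨hN, le_rfl⟩
  rwa [div_self (by exact_mod_cast hN.ne')] at h

/-- For a continuous path the grid maxima converge to the maximum. The grid omits `0`, so a point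
`t` is approximated by `max 1 ⌈t N⌉ / N`. -/
theorem tendsto_gridMax (hc : Continuous fun t => B t ω) :
    Tendsto (fun N => gridMax B N ω) atTop (𝓝 (unitMax B ω)) := by
  refine tendsto_order.2 ⟨fun a ha => ?_, fun a ha => ?_⟩
  · obtain ⟨⟨t, ht⟩, hta⟩ := exists_lt_of_lt_ciSup ha
    have hlim : Tendsto (fun N : ℕ => ((max 1 ⌈t * N⌉₊ : ℕ) : ℝ≥0) / N) atTop (𝓝 t) := by
      have hu : Tendsto (fun N : ℕ => t + (1 : ℝ≥0) / N) atTop (𝓝 (t + 0)) :=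
        tendsto_const_nhds.add (tendsto_const_div_atTop_nhds_zero_nat 1)
      rw [add_zero] at hu
      refine tendsto_of_tendsto_of_tendsto_of_le_of_le' tendsto_const_nhds hu ?_ ?_
      · filter_upwards [eventually_gt_atTop 0] with N hN
        have hN' : (0 : ℝ≥0) < N := by exact_mod_cast hN
        rw [le_div_iff₀ hN']
        exact (Nat.le_ceil _).trans (by exact_mod_cast le_max_right _ _)
      · filter_upwards [eventually_gt_atTop 0] with N hN
        have hN' : (0 : ℝ≥0) < N := by exact_mod_cast hN
        rw [div_le_iff₀ hN', add_mul, div_mul_cancel₀ _ hN'.ne', Nat.cast_max]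
        exact max_le (by simp) (Nat.ceil_lt_add_one zero_le).le
    have h2 := ((hc.tendsto t).comp hlim).eventually (lt_mem_nhds hta)
    filter_upwards [h2, eventually_gt_atTop 0] with N hN hN0
    refine lt_of_lt_of_le hN (le_gridMax ⟨le_max_left _ _, max_le hN0 (Nat.ceil_le.2 ?_)⟩)
    exact mul_le_of_le_one_left zero_le ht.2
  · filter_upwards [eventually_gt_atTop 0] with N hN
    exact (gridMax_le_unitMax hc hN).trans_lt ha

end Path

section FractionalBrownianMotion

variable {Ω : Type*} [MeasurableSpace Ω] {P : Measure Ω} {H : ℝ} {B : ℝ≥0 → Ω → ℝ}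

theorem IsFractionalBrownianMotion.integral_sub_sq
    (hB : IsFractionalBrownianMotion H B P) (hH : 0 < H) (s t : ℝ≥0) :
    ∫ ω, (B s ω - B t ω) ^ 2 ∂P = |(s : ℝ) - t| ^ (2 * H) := by
  have hL : ∀ u, MemLp (B u) 2 P := fun u =>
    (hB.isGaussianProcess.hasGaussianLaw_eval u).memLp_two
  have hi : ∀ u v, Integrable (fun ω => B u ω * B v ω) P := fun u v =>
    (hL u).integrable_mul (hL v)
  have h : ∀ ω, (B s ω - B t ω) ^ 2 =
      B s ω * B s ω - 2 * (B s ω * B t ω) + B t ω * B t ω := fun ω => by ring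
  simp_rw [h]
  have hi2 : Integrable (fun ω => B s ω * B s ω - 2 * (B s ω * B t ω)) P :=
    (hi s s).sub ((hi s t).const_mul 2)
  rw [integral_add hi2 (hi t t),
    integral_sub (hi s s) ((hi s t).const_mul 2), integral_const_mul, hB.covariance_eq,
    hB.covariance_eq, hB.covariance_eq, sub_self, sub_self, abs_zero,
    Real.zero_rpow (by positivity)]
  ring

theorem IsFractionalBrownianMotion.hasGaussianLaw_comp {ι : Type*} [Fintype ι]
    (hB : IsFractionalBrownianMotion H B P)
    (t : ι → ℝ≥0) : HasGaussianLaw (fun ω i => B (t i) ω) P := by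
  have h := (hB.isGaussianProcess.comp_right t).hasGaussianLaw Finset.univ
  exact h.map_fun (ContinuousLinearMap.pi fun i =>
    ContinuousLinearMap.proj (R := ℝ) (φ := fun _ : (Finset.univ : Finset ι) => ℝ)
      ⟨i, Finset.mem_univ i⟩)

theorem IsFractionalBrownianMotion.integrable_gridMax
    (hB : IsFractionalBrownianMotion H B P) {n : ℕ} (hn : 0 < n) :
    Integrable (gridMax B n) P := by
  have : Nonempty (Set.Icc 1 n) := ⟨⟨n, hn, le_rfl⟩⟩
  exact integrable_iSup_of_hasGaussianLaw
    (hB.hasGaussianLaw_comp fun i : Set.Icc 1 n => ((i : ℕ) : ℝ≥0) / (n : ℝ≥0))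

/-- Refining the grid of mesh `1 / N` by a factor `m`. A fine grid point is compared with the next
coarse grid point to its right, at distance at most `(1 - 1 / m) / N`. -/
theorem integral_gridMax_mul_le (hH0 : 0 < H) (hH1 : H < 1 / 2)
    (hB : IsFractionalBrownianMotion H B P) {N m : ℕ} (hN : 0 < N) (hm : 2 ≤ m) :
    ∫ ω, gridMax B (N * m) ω ∂P ≤ ∫ ω, gridMax B N ω ∂P +
      √(((1 - (m : ℝ)⁻¹) / N) ^ (2 * H) * Real.log ((N * m : ℕ) : ℝ)) := by
  have hm0 : 0 < m := by omega
  have hNm : 0 < N * m := Nat.mul_pos hN hm0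
  have hN' : (0 : ℝ) < N := by exact_mod_cast hN
  have hm' : (0 : ℝ) < m := by exact_mod_cast hm0
  have hm1 : (1 : ℝ) < m := by exact_mod_cast hm
  have : Nonempty (Set.Icc 1 (N * m)) := ⟨⟨N * m, hNm, le_rfl⟩⟩
  -- The next coarse grid point is `c i / N` with `c i = ⌈i / m⌉`.
  let c : Set.Icc 1 (N * m) → Set.Icc 1 N := fun i => ⟨((i : ℕ) + m - 1) / m, by
    have h1 := i.2.1
    have h2 := i.2.2
    refine ⟨(Nat.le_div_iff_mul_le hm0).2 (by omega), ?_⟩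
    exact Nat.lt_succ_iff.1 ((Nat.div_lt_iff_lt_mul hm0).2 (by rw [Nat.succ_mul]; omega))⟩
  have hc1 : ∀ i : Set.Icc 1 (N * m), ((i : ℕ) : ℝ) ≤ ((c i : ℕ) : ℝ) * m := by
    intro i
    have h1 := Nat.lt_div_mul_add hm0 (a := (i : ℕ) + m - 1)
    have h2 := i.2.1
    have h3 : (i : ℕ) ≤ (c i : ℕ) * m := by
      change (i : ℕ) ≤ ((i : ℕ) + m - 1) / m * m
      omega
    exact_mod_cast h3
  have hc2 : ∀ i : Set.Icc 1 (N * m), ((c i : ℕ) : ℝ) * m ≤ ((i : ℕ) : ℝ) + (m - 1) := by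
    intro i
    have h1 := Nat.div_mul_le_self ((i : ℕ) + m - 1) m
    have h3 : (c i : ℕ) * m + 1 ≤ (i : ℕ) + m := by
      change ((i : ℕ) + m - 1) / m * m + 1 ≤ _
      omega
    have h4 : ((c i : ℕ) : ℝ) * m + 1 ≤ ((i : ℕ) : ℝ) + m := by exact_mod_cast h3
    linarith
  have hsurj : Function.Surjective c := by
    rintro ⟨j, hj1, hj2⟩
    refine ⟨⟨j * m, Nat.mul_pos hj1 hm0, Nat.mul_le_mul_right m hj2⟩, Subtype.ext ?_⟩
    change (j * m + m - 1) / m = j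
    rw [Nat.add_sub_assoc hm0, mul_comm, Nat.mul_add_div hm0, Nat.div_eq_of_lt (by omega), add_zero]
  have hγ0 : 0 < (1 - (m : ℝ)⁻¹) / N := div_pos (sub_pos.2 (inv_lt_one_of_one_lt₀ hm1)) hN'
  have hcard : Fintype.card (Set.Icc 1 (N * m)) = N * m := by
    rw [Fintype.card_ofFinset, Nat.card_Icc]
    omega
  have h := integral_iSup_sub_le_sqrt_of_hasGaussianLaw
    (hB.hasGaussianLaw_comp fun i => ((c i : ℕ) : ℝ≥0) / (N : ℝ≥0))
    (hB.hasGaussianLaw_comp fun i : Set.Icc 1 (N * m) =>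
      ((i : ℕ) : ℝ≥0) / ((N * m : ℕ) : ℝ≥0))
    (fun i => hB.mean_eq_zero _) (fun i => hB.mean_eq_zero _)
    (γ := ((1 - (m : ℝ)⁻¹) / N) ^ (2 * H)) (Real.rpow_pos_of_pos hγ0 _) (fun i j => by
      rw [hB.integral_sub_sq hH0, hB.integral_sub_sq hH0]
      push_cast
      -- Both shifts to the right lie in `[0, (1 - 1 / m) / N]`, hence so does their distance; the
      -- subadditivity of `x ↦ x ^ (2 H)` for `2 H < 1` then bounds the change of the variance.
      have hd : |((i : ℕ) : ℝ) / (N * m) - ((j : ℕ) : ℝ) / (N * m)| ≤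
          |((c i : ℕ) : ℝ) / N - ((c j : ℕ) : ℝ) / N| + (1 - (m : ℝ)⁻¹) / N := by
        have e1 : ((i : ℕ) : ℝ) / (N * m) - ((j : ℕ) : ℝ) / (N * m) =
            (((c i : ℕ) : ℝ) / N - ((c j : ℕ) : ℝ) / N) +
            ((((c j : ℕ) : ℝ) * m - (j : ℕ)) - (((c i : ℕ) : ℝ) * m - (i : ℕ))) / (N * m) := by
          field_simp
          ring
        have e2 : (1 - (m : ℝ)⁻¹) / N = (m - 1) / (N * m) := by
          field_simp
        rw [e1, e2]
        refine (abs_add_le _ _).trans ?_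
        gcongr
        rw [abs_div, abs_of_pos (by positivity : (0 : ℝ) < N * m)]
        gcongr
        rw [abs_le]
        have := hc1 i
        have := hc1 j
        have := hc2 i
        have := hc2 j
        constructor <;> linarith
      refine (Real.rpow_le_rpow (abs_nonneg _) hd (by positivity)).trans ?_
      exact Real.rpow_add_le_add_rpow (abs_nonneg _) hγ0.le (by positivity) (by linarith))
    (by
      rw [hcard]
      have := Nat.mul_le_mul hN hm
      omega)
  have hsup : ∀ ω, ⨆ i, B (((c i : ℕ) : ℝ≥0) / (N : ℝ≥0)) ω = gridMax B N ω := fun ω =>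
    hsurj.iSup_comp fun j : Set.Icc 1 N => B (((j : ℕ) : ℝ≥0) / (N : ℝ≥0)) ω
  simp_rw [hsup] at h
  rwa [hcard] at h

end FractionalBrownianMotion

/-! ### Summation over the refinements -/

section Refinement

variable {Ω : Type*} [MeasurableSpace Ω] {P : Measure Ω} {H : ℝ} {B : ℝ≥0 → Ω → ℝ}

theorem Admissible.two_le_rpow {α : ℝ} {n : ℕ} (h : Admissible H α n) : 2 ≤ (n : ℝ) ^ α := by
  obtain ⟨hα, hn, -⟩ := h
  have h1 := Real.rpow_le_rpow (by positivity) ((le_max_left _ _).trans hn) hα.le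
  rwa [← Real.rpow_mul (by norm_num), one_div_mul_cancel hα.ne', Real.rpow_one] at h1

theorem Admissible.one_lt {α : ℝ} {n : ℕ} (h : Admissible H α n) : 1 < (n : ℝ) := by
  obtain ⟨hα, hn, -⟩ := h
  exact (Real.one_lt_rpow one_lt_two (by positivity)).trans_le ((le_max_left _ _).trans hn)

theorem Admissible.two_le_floor {α : ℝ} {n : ℕ} (h : Admissible H α n) :
    2 ≤ ⌊(n : ℝ) ^ α⌋₊ :=
  Nat.le_floor (by exact_mod_cast h.two_le_rpow)

theorem geomRatio_nonneg {α : ℝ} (hα : 0 < α) (n : ℕ) : 0 ≤ geomRatio H α n := by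
  unfold geomRatio
  positivity

/-- The error of the `k`-th refinement is dominated by a geometric sequence: Bernoulli's inequality
`1 + (k + 1) α ≤ (1 + α) (1 + α / (1 + α)) ^ k` controls the logarithm. -/
theorem Admissible.sqrt_le {α : ℝ} {n : ℕ} (h : Admissible H α n) {m : ℕ}
    (hm : m = ⌊(n : ℝ) ^ α⌋₊) (k : ℕ) :
    √(((1 - (m : ℝ)⁻¹) / (n * m ^ k : ℕ)) ^ (2 * H) * Real.log ((n * m ^ k * m : ℕ) : ℝ)) ≤
      (n : ℝ) ^ (-H) * (Real.log n) ^ (1 / 2 : ℝ) *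
        ((1 - (m : ℝ)⁻¹) ^ H * (1 + α) ^ (1 / 2 : ℝ)) * geomRatio H α n ^ k := by
  have hα := h.1
  have hn1 := h.one_lt
  have hn0 : (0 : ℝ) < n := by linarith
  have hm2 : 2 ≤ m := hm ▸ h.two_le_floor
  have hm2' : (2 : ℝ) ≤ m := by exact_mod_cast hm2
  have hm0 : (0 : ℝ) < m := by linarith
  have hlog : 0 < Real.log n := Real.log_pos hn1
  have hq : 0 ≤ 1 - (m : ℝ)⁻¹ := sub_nonneg.2 (inv_le_one_of_one_le₀ (by linarith))
  have hlogm : Real.log m ≤ α * Real.log n := by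
    rw [← Real.log_rpow hn0]
    exact Real.log_le_log hm0 (hm ▸ Nat.floor_le (by positivity))
  have hL : Real.log ((n * m ^ k * m : ℕ) : ℝ) ≤
      Real.log n * ((1 + α) * (1 + α / (1 + α)) ^ k) := by
    have hb : 1 + (k : ℝ) * (α / (1 + α)) ≤ (1 + α / (1 + α)) ^ k :=
      one_add_mul_le_pow (by have : 0 ≤ α / (1 + α) := by positivity
                             linarith) k
    have hb2 := mul_le_mul_of_nonneg_left hb (by positivity : 0 ≤ 1 + α)
    have e : (1 + α) * (1 + (k : ℝ) * (α / (1 + α))) = 1 + (k + 1) * α := by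
      field_simp
      ring
    rw [e] at hb2
    have e2 : Real.log ((n * m ^ k * m : ℕ) : ℝ) = Real.log n + (k + 1) * Real.log m := by
      push_cast
      rw [mul_assoc, ← pow_succ, Real.log_mul hn0.ne' (by positivity), Real.log_pow]
      push_cast
      rfl
    rw [e2]
    have h1 : (k + 1 : ℝ) * Real.log m ≤ (k + 1) * (α * Real.log n) := by gcongr
    have h2 := mul_le_mul_of_nonneg_left hb2 hlog.le
    linarith
  have hmk : (0 : ℝ) < m ^ k := by positivity
  calc _ ≤ √(((1 - (m : ℝ)⁻¹) / (n * m ^ k : ℕ)) ^ (2 * H) *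
        (Real.log n * ((1 + α) * (1 + α / (1 + α)) ^ k))) := by gcongr
    _ = _ := by
      unfold geomRatio
      rw [← hm]
      push_cast
      simp only [← Real.sqrt_eq_rpow]
      have hs : ((1 - (m : ℝ)⁻¹) / (n * m ^ k)) ^ (2 * H) =
          ((n : ℝ) ^ (-H) * (1 - (m : ℝ)⁻¹) ^ H * ((m : ℝ) ^ (-H)) ^ k) ^ 2 := by
        rw [mul_comm 2 H, Real.rpow_mul (by positivity), Real.rpow_two,
          Real.div_rpow hq (by positivity), Real.mul_rpow hn0.le hmk.le, Real.rpow_neg hn0.le,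
          Real.rpow_neg hm0.le, inv_pow, Real.rpow_pow_comm hm0.le]
        field_simp
      have hs0 : 0 ≤ (n : ℝ) ^ (-H) * (1 - (m : ℝ)⁻¹) ^ H * ((m : ℝ) ^ (-H)) ^ k := by positivity
      have hs1 : √((1 + α / (1 + α)) ^ k) = √(1 + α / (1 + α)) ^ k := by
        rw [Real.sqrt_eq_iff_eq_sq (by positivity) (by positivity), ← pow_mul, mul_comm k 2,
          pow_mul, Real.sq_sqrt (by positivity)]
      rw [hs, Real.sqrt_mul (by positivity), Real.sqrt_sq hs0, Real.sqrt_mul hlog.le,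
        Real.sqrt_mul (by positivity), hs1, mul_pow]
      ring

/-- Summing the geometric errors of all refinements; the bound is uniform in their number `K`. -/
theorem Admissible.integral_gridMax_le (hH0 : 0 < H) (hH1 : H < 1 / 2)
    (hB : IsFractionalBrownianMotion H B P) {α : ℝ} {n : ℕ} (h : Admissible H α n) (K : ℕ) :
    ∫ ω, gridMax B (n * ⌊(n : ℝ) ^ α⌋₊ ^ K) ω ∂P ≤ ∫ ω, gridMax B n ω ∂P +
      (n : ℝ) ^ (-H) * (Real.log n) ^ (1 / 2 : ℝ) * upperFactor H α n := by
  obtain ⟨m, hm⟩ : ∃ m, m = ⌊(n : ℝ) ^ α⌋₊ := ⟨_, rfl⟩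
  have hm2 : 2 ≤ m := hm ▸ h.two_le_floor
  have hm2' : (2 : ℝ) ≤ m := by exact_mod_cast hm2
  have hn0 : 0 < n := by
    have := h.one_lt
    exact_mod_cast zero_lt_one.trans this
  have hr0 : 0 ≤ geomRatio H α n := geomRatio_nonneg h.1 n
  have hr1 : geomRatio H α n < 1 := h.2.2
  have hq : 0 ≤ 1 - (m : ℝ)⁻¹ := sub_nonneg.2 (inv_le_one_of_one_le₀ (by linarith))
  have hα := h.1
  have hlog : 0 < Real.log n := Real.log_pos h.one_lt
  set A := (n : ℝ) ^ (-H) * (Real.log n) ^ (1 / 2 : ℝ) *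
        ((1 - (m : ℝ)⁻¹) ^ H * (1 + α) ^ (1 / 2 : ℝ)) with hA
  have hA0 : 0 ≤ A := by positivity
  have ind : ∀ k : ℕ, ∫ ω, gridMax B (n * m ^ k) ω ∂P ≤ ∫ ω, gridMax B n ω ∂P +
      ∑ j ∈ Finset.range k, A * geomRatio H α n ^ j := by
    intro k
    induction k with
    | zero => simp
    | succ k ih =>
      have h1 := integral_gridMax_mul_le hH0 hH1 hB (N := n * m ^ k) (m := m) (by positivity) hm2
      have h2 := h.sqrt_le hm k
      rw [Finset.sum_range_succ, pow_succ, ← mul_assoc]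
      linarith
  rw [← hm]
  refine (ind K).trans ?_
  gcongr
  have hg : ∑ j ∈ Finset.range K, geomRatio H α n ^ j ≤ (1 - geomRatio H α n)⁻¹ := by
    rw [← tsum_geometric_of_lt_one hr0 hr1]
    exact (summable_geometric_of_lt_one hr0 hr1).sum_le_tsum _ fun j _ => pow_nonneg hr0 j
  rw [← Finset.mul_sum]
  refine (mul_le_mul_of_nonneg_left hg hA0).trans_eq ?_
  rw [upperFactor, ← hm, hA]
  ring

theorem IsFractionalBrownianMotion.ae_tendsto_gridMax (hB : IsFractionalBrownianMotion H B P) :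
    ∀ᵐ ω ∂P, Tendsto (fun N => gridMax B N ω) atTop (𝓝 (unitMax B ω)) := by
  filter_upwards [hB.continuous_paths] with ω hω using tendsto_gridMax hω

theorem tendsto_mul_pow_atTop {n m : ℕ} (hn : 0 < n) (hm : 2 ≤ m) :
    Tendsto (fun k => n * m ^ k) atTop atTop :=
  (tendsto_pow_atTop_atTop_of_one_lt (by omega)).const_mul_atTop' hn

theorem IsFractionalBrownianMotion.integrable_apply
    (hB : IsFractionalBrownianMotion H B P) (t : ℝ≥0) :
    Integrable (B t) P :=
  (hB.isGaussianProcess.hasGaussianLaw_eval t).integrable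

/-- `unitMax` is integrable by Fatou's lemma, since the expected maxima over the refined grids stay
bounded. -/
theorem Admissible.integrable_unitMax (hH0 : 0 < H) (hH1 : H < 1 / 2)
    (hB : IsFractionalBrownianMotion H B P) {α : ℝ} {n : ℕ} (h : Admissible H α n) :
    Integrable (unitMax B) P := by
  have hn0 : 0 < n := by
    have := h.one_lt
    exact_mod_cast zero_lt_one.trans this
  set m := ⌊(n : ℝ) ^ α⌋₊ with hm
  have hm2 : 2 ≤ m := h.two_le_floor
  have hpos : ∀ k : ℕ, 0 < n * m ^ k := fun k => by positivity
  have hi : ∀ k, Integrable (fun ω => gridMax B (n * m ^ k) ω - B 1 ω) P := fun k =>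
    (hB.integrable_gridMax (hpos k)).sub (hB.integrable_apply 1)
  have hsub : Integrable (fun ω => unitMax B ω - B 1 ω) P := by
    have hlim : ∀ᵐ ω ∂P, Tendsto (fun k => gridMax B (n * m ^ k) ω - B 1 ω) atTop
        (𝓝 (unitMax B ω - B 1 ω)) := by
      filter_upwards [hB.ae_tendsto_gridMax] with ω hω
      exact (hω.comp (tendsto_mul_pow_atTop hn0 hm2)).sub_const _
    refine ⟨aestronglyMeasurable_of_tendsto_ae _ (fun k => (hi k).aestronglyMeasurable) hlim, ?_⟩
    have hbound : ∀ k, ∫⁻ ω, ‖gridMax B (n * m ^ k) ω - B 1 ω‖ₑ ∂P ≤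
        ENNReal.ofReal (∫ ω, gridMax B n ω ∂P +
          (n : ℝ) ^ (-H) * (Real.log n) ^ (1 / 2 : ℝ) * upperFactor H α n) := by
      intro k
      rw [← ofReal_integral_norm_eq_lintegral_enorm (hi k)]
      gcongr
      have hn : ∀ ω, ‖gridMax B (n * m ^ k) ω - B 1 ω‖ = gridMax B (n * m ^ k) ω - B 1 ω :=
        fun ω => abs_of_nonneg (sub_nonneg.2 (apply_one_le_gridMax (hpos k)))
      simp_rw [hn]
      rw [integral_sub (hB.integrable_gridMax (hpos k)) (hB.integrable_apply 1),
        hB.mean_eq_zero, sub_zero]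
      exact h.integral_gridMax_le hH0 hH1 hB k
    calc ∫⁻ ω, ‖unitMax B ω - B 1 ω‖ₑ ∂P
        = ∫⁻ ω, liminf (fun k => ‖gridMax B (n * m ^ k) ω - B 1 ω‖ₑ) atTop ∂P :=
          lintegral_congr_ae (by filter_upwards [hlim] with ω hω using hω.enorm.liminf_eq.symm)
      _ ≤ liminf (fun k => ∫⁻ ω, ‖gridMax B (n * m ^ k) ω - B 1 ω‖ₑ ∂P) atTop :=
          lintegral_liminf_le' fun k => (hi k).aestronglyMeasurable.enorm
      _ ≤ _ := liminf_le_of_frequently_le' (Frequently.of_forall hbound)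
      _ < ⊤ := ENNReal.ofReal_lt_top
  exact (hsub.add (hB.integrable_apply 1)).congr (ae_of_all _ fun ω => by simp)

theorem Admissible.discretizationError_le (hH0 : 0 < H) (hH1 : H < 1 / 2)
    (hB : IsFractionalBrownianMotion H B P) {α : ℝ} {n : ℕ} (h : Admissible H α n) :
    discretizationError B P n ≤
      (n : ℝ) ^ (-H) * (Real.log n) ^ (1 / 2 : ℝ) * upperFactor H α n := by
  have hn0 : 0 < n := by
    have := h.one_lt
    exact_mod_cast zero_lt_one.trans this
  have hiU := h.integrable_unitMax hH0 hH1 hB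
  have hi1 := hB.integrable_apply 1
  set m := ⌊(n : ℝ) ^ α⌋₊ with hm
  have hm2 : 2 ≤ m := h.two_le_floor
  have hpos : ∀ k : ℕ, 0 < n * m ^ k := fun k => by positivity
  have hlim : Tendsto (fun k => ∫ ω, gridMax B (n * m ^ k) ω ∂P) atTop
      (𝓝 (∫ ω, unitMax B ω ∂P)) := by
    refine tendsto_integral_of_dominated_convergence (fun ω => |unitMax B ω| + |B 1 ω|)
      (fun k => (hB.integrable_gridMax (hpos k)).aestronglyMeasurable) (hiU.abs.add hi1.abs)
      (fun k => ?_) ?_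
    · filter_upwards [hB.continuous_paths] with ω hω
      have h1 := gridMax_le_unitMax hω (hpos k)
      have h2 := apply_one_le_gridMax (B := B) (ω := ω) (hpos k)
      rw [Real.norm_eq_abs, abs_le]
      constructor
      · linarith [neg_abs_le (B 1 ω), abs_nonneg (unitMax B ω)]
      · linarith [le_abs_self (unitMax B ω), abs_nonneg (B 1 ω)]
    · filter_upwards [hB.ae_tendsto_gridMax] with ω hω
      exact hω.comp (tendsto_mul_pow_atTop hn0 hm2)
  have hle := le_of_tendsto' hlim fun k => h.integral_gridMax_le hH0 hH1 hB k
  rw [discretizationError]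
  linarith

end Refinement

/-! ### Asymptotics of the bound -/

section Asymptotics

variable {H : ℝ} {α : ℕ → ℝ}

/-- A nonpositive exponent would give `n ^ α n ≤ 1`. -/
theorem eventually_pos_of_tendsto_rpow (h : Tendsto (fun n : ℕ => (n : ℝ) ^ α n) atTop atTop) :
    ∀ᶠ n in atTop, 0 < α n := by
  filter_upwards [h.eventually_gt_atTop 1, eventually_ge_atTop 1] with n h1 h2
  by_contra! h3
  exact absurd (Real.rpow_le_one_of_one_le_of_nonpos (by exact_mod_cast h2) h3) (not_le.2 h1)

theorem tendsto_natFloor_rpow (h : Tendsto (fun n : ℕ => (n : ℝ) ^ α n) atTop atTop) :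
    Tendsto (fun n : ℕ => (⌊(n : ℝ) ^ α n⌋₊ : ℝ)) atTop atTop :=
  tendsto_natCast_atTop_atTop.comp (tendsto_nat_floor_atTop.comp h)

theorem tendsto_div_one_add (h0 : Tendsto α atTop (𝓝 0)) :
    Tendsto (fun n => 1 + α n / (1 + α n)) atTop (𝓝 1) := by
  have h1 : Tendsto (fun n => 1 + α n) atTop (𝓝 (1 + 0)) := h0.const_add 1
  simpa using (h0.div h1 (by norm_num)).const_add 1

theorem tendsto_geomRatio (hH0 : 0 < H) (h0 : Tendsto α atTop (𝓝 0))
    (h : Tendsto (fun n : ℕ => (n : ℝ) ^ α n) atTop atTop) :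
    Tendsto (fun n => geomRatio H (α n) n) atTop (𝓝 0) := by
  have h1 := (tendsto_rpow_neg_atTop hH0).comp (tendsto_natFloor_rpow h)
  have h2 := (tendsto_div_one_add h0).rpow_const (p := 1 / 2) (Or.inl one_ne_zero)
  simpa [geomRatio] using h1.mul h2

theorem tendsto_upperFactor (hH0 : 0 < H) (h0 : Tendsto α atTop (𝓝 0))
    (h : Tendsto (fun n : ℕ => (n : ℝ) ^ α n) atTop atTop) :
    Tendsto (fun n => upperFactor H (α n) n) atTop (𝓝 1) := by
  have h1 : Tendsto (fun n : ℕ => (1 - (⌊(n : ℝ) ^ α n⌋₊ : ℝ)⁻¹) ^ H) atTop (𝓝 ((1 - 0) ^ H)) :=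
    ((tendsto_inv_atTop_zero.comp (tendsto_natFloor_rpow h)).const_sub 1).rpow_const
      (Or.inl (by norm_num))
  have h2 : Tendsto (fun n => (1 + α n) ^ (1 / 2 : ℝ)) atTop (𝓝 ((1 + 0) ^ (1 / 2 : ℝ))) :=
    (h0.const_add 1).rpow_const (Or.inl (by norm_num))
  have h3 := (tendsto_geomRatio hH0 h0 h).const_sub 1
  simpa [upperFactor, Pi.div_def] using (h1.mul h2).div h3 (by norm_num)

theorem eventually_admissible (hH0 : 0 < H) (h0 : Tendsto α atTop (𝓝 0))
    (h : Tendsto (fun n : ℕ => (n : ℝ) ^ α n) atTop atTop) :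
    ∀ᶠ n in atTop, Admissible H (α n) n := by
  have h2H := (tendsto_rpow_atTop (by positivity : 0 < 2 * H)).comp h
  filter_upwards [eventually_pos_of_tendsto_rpow h, h.eventually_ge_atTop 2,
    h2H.eventually_ge_atTop 2, (tendsto_div_one_add h0).eventually_le_const one_lt_two,
    (tendsto_geomRatio hH0 h0 h).eventually_lt_const one_pos] with n hα h2 h3 h4 h5
  have hn : (0 : ℝ) ≤ n := Nat.cast_nonneg n
  refine ⟨hα, max_le ?_ ?_, h5⟩
  · rw [one_div, Real.rpow_inv_le_iff_of_pos (by norm_num) hn hα]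
    exact h2
  · rw [one_div, Real.rpow_inv_le_iff_of_pos (by positivity) hn (by positivity),
      show 2 * α n * H = α n * (2 * H) by ring, Real.rpow_mul hn]
    exact h4.trans h3

/-- The exponent `ln ln n / ln n`, for which `n ^ α = ln n`. -/
noncomputable def logLogExponent (n : ℕ) : ℝ := Real.log (Real.log n) / Real.log n

theorem tendsto_log_natCast : Tendsto (fun n : ℕ => Real.log n) atTop atTop :=
  Real.tendsto_log_atTop.comp tendsto_natCast_atTop_atTop

theorem tendsto_logLogExponent : Tendsto logLogExponent atTop (𝓝 0) :=
  (Real.isLittleO_log_id_atTop.comp_tendsto tendsto_log_natCast).tendsto_div_nhds_zero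

theorem tendsto_rpow_logLogExponent :
    Tendsto (fun n : ℕ => (n : ℝ) ^ logLogExponent n) atTop atTop := by
  refine tendsto_log_natCast.congr' ?_
  filter_upwards [eventually_gt_atTop 0, tendsto_log_natCast.eventually_gt_atTop 0] with n h1 h2
  rw [logLogExponent, Real.rpow_def_of_pos (by exact_mod_cast h1), mul_div_cancel₀ _ h2.ne',
    Real.exp_log h2]

end Asymptotics

theorem theorem1 {Ω : Type*} [MeasurableSpace Ω] (P : Measure Ω)
    (H : ℝ) (hH0 : 0 < H) (hH1 : H < 1 / 2)
    (B : ℝ≥0 → Ω → ℝ) (hB : IsFractionalBrownianMotion H B P) :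
    -- the expected maxima are genuine (finite) expectations
    (Integrable (unitMax B) P ∧ ∀ n : ℕ, 1 ≤ n → Integrable (gridMax B n) P) ∧
    -- the non-asymptotic upper bound
    (∀ (α : ℝ) (n : ℕ), Admissible H α n →
      discretizationError B P n / ((n : ℝ) ^ (-H) * (Real.log n) ^ (1 / 2 : ℝ)) ≤
        upperFactor H α n) ∧
    -- if `α → 0` so slowly that `n ^ α → ∞`, the bound eventually applies and tends to `1`
    (∀ α : ℕ → ℝ, Tendsto α atTop (𝓝 0) →
      Tendsto (fun n : ℕ => (n : ℝ) ^ α n) atTop atTop →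
      (∀ᶠ n : ℕ in atTop, Admissible H (α n) n) ∧
        Tendsto (fun n : ℕ => upperFactor H (α n) n) atTop (𝓝 1)) ∧
    -- consequently `Δ_n ≤ n ^ (-H) (ln n) ^ (1/2) (1 + o(1))`
    (∃ ε : ℕ → ℝ, Tendsto ε atTop (𝓝 0) ∧ ∀ᶠ n : ℕ in atTop,
      discretizationError B P n ≤
        (n : ℝ) ^ (-H) * (Real.log n) ^ (1 / 2 : ℝ) * (1 + ε n)) := by
  have hadm := eventually_admissible hH0 tendsto_logLogExponent tendsto_rpow_logLogExponent
  refine ⟨⟨?_, fun n hn => hB.integrable_gridMax hn⟩, fun α n h => ?_,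
    fun α h0 h => ⟨eventually_admissible hH0 h0 h, tendsto_upperFactor hH0 h0 h⟩,
    fun n => upperFactor H (logLogExponent n) n - 1, ?_, ?_⟩
  · obtain ⟨n, hn⟩ := hadm.exists
    exact hn.integrable_unitMax hH0 hH1 hB
  · have hn := h.one_lt
    have hlog := Real.log_pos hn
    rw [div_le_iff₀' (by positivity)]
    exact h.discretizationError_le hH0 hH1 hB
  · simpa using
      (tendsto_upperFactor hH0 tendsto_logLogExponent tendsto_rpow_logLogExponent).sub_const 1
  · filter_upwards [hadm] with n hn
    rw [add_sub_cancel]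
    exact hn.discretizationError_le hH0 hH1 hB
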